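/- Let $(W,S)$ be a Coxeter system with $W$ finite, let $\ell$ be its length function and let $T=\bigcup_{w\in W} wSw^{-1}$ be its set of reflections. For $w\in W$ let $N(w)=\{t\in T : \ell(tw)<\ell(w)\}$ be its inversion set. The right weak order on $W$ is given by $u\le_R v$ if and only if $\ell(v)=\ell(u)+\ell(u^{-1}v)$, and $u\vee_R v$ denotes the join (least upper bound) of $u$ and $v$ in this order. For $A\subseteq T$ the Bruhat preclosure $\overline{A}$ is the set of all $t\in T$ for which there are $n\ge 0$ and $t_1,\dots,t_n\in A$ with $t=t_1t_2\cdots t_n$ and $\ell(t_1\cdots t_{k-1})<\ell(t_1\cdots t_k)$ for $1\le k\le n$ (that is, $t$ can be reached from the identity by a directed path in the Bruhat graph all of whose edges are labelled by elements of $A$). Write $\overline{A}^{\,0}=A$ and $\overline{A}^{\,i+1}=\overline{\overline{A}^{\,i}}$. Then for all $u,v\in W$ the join $u\vee_R v$ exists, and there is an integer $i$ with $0\le i\le |T|-|N(u)\cup N(v)|$ such that \[ N(u\vee_R v)=\overline{N(u)\cup N(v)}^{\,i}. \] -/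

import Mathlib

namespace CoxeterSystem

variable {B W : Type*} [Group W] {M : CoxeterMatrix B}

/-- The set `T` of all reflections of a Coxeter system. -/
def reflections (cs : CoxeterSystem M W) : Set W :=
  {t | cs.IsReflection t}

/-- The inversion set `N(w) = {t ∈ T | ℓ(t w) < ℓ(w)}`. -/
def inversionSet (cs : CoxeterSystem M W) (w : W) : Set W :=
  {t | t ∈ cs.reflections ∧ cs.length (t * w) < cs.length w}

/-- The right weak order on `W`: `u ≤ v` if and only if `ℓ(v) = ℓ(u) + ℓ(u⁻¹ v)`. -/
@[reducible]
def rightWeakOrder (cs : CoxeterSystem M W) : PartialOrder W where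
  le u v := cs.length v = cs.length u + cs.length (u⁻¹ * v)
  le_refl u := by simp
  le_trans u v w huv hvw := by
    have h1 := cs.length_mul_le u (u⁻¹ * w)
    have h2 := cs.length_mul_le (u⁻¹ * v) (v⁻¹ * w)
    rw [mul_inv_cancel_left] at h1
    rw [mul_assoc, mul_inv_cancel_left] at h2
    omega
  le_antisymm u v huv hvu := by
    have h : cs.length (u⁻¹ * v) = 0 := by omega
    rw [cs.length_eq_zero_iff] at h
    exact inv_mul_eq_one.mp h

/-- `w` is the join `u ∨ v` in the right weak order, i.e. the least upper bound of `{u, v}`. -/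
def IsRightWeakJoin (cs : CoxeterSystem M W) (u v w : W) : Prop :=
  @IsLUB W cs.rightWeakOrder.toLE {u, v} w

/-- The Bruhat graph has a directed edge from `u` to `v` with label `t`:
`t` is a reflection, `v = u t` and `ℓ(u) < ℓ(v)`. -/
def BruhatEdge (cs : CoxeterSystem M W) (u t v : W) : Prop :=
  t ∈ cs.reflections ∧ v = u * t ∧ cs.length u < cs.length v

/-- There is a (right) `A`-path from `u` to `v`: a finite directed path in the Bruhat graph all of
whose edges have labels in `A`. -/
def ExistsBruhatPath (cs : CoxeterSystem M W) (A : Set W) (u v : W) : Prop :=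
  Relation.ReflTransGen (fun x y => ∃ t ∈ A, cs.BruhatEdge x t y) u v

/-- The (right) Bruhat preclosure of `A`: the reflections that are reached from the identity
by an `A`-path. -/
def bruhatPreclosure (cs : CoxeterSystem M W) (A : Set W) : Set W :=
  {t | t ∈ cs.reflections ∧ cs.ExistsBruhatPath A 1 t}

end CoxeterSystem

/-! Right weak order is inclusion of inversion sets, and each N(w) is closed under Bruhat
preclosure. It suffices to find an upper bound w of u, v with N(w) inside every closed C containing
N(u) and N(v) (`exists_upperBound_subset_closed`): C = N(x) makes w the join, and C a stable iterate
of the preclosure gives the formula. Such a w is built by going up from a common lower bound x.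
Covers x s_i ≤ u and x s_j ≤ v are bounded by z = xy, with y longest in the parabolic subgroup
generated by s_i and s_j (`exists_local_upperBound`); one then bounds u with z over x s_i, and the
result with v over x s_j. The computations rest on a mod 2 cocycle that detects inversions. -/

namespace CoxeterSystem

/-! ### The mod 2 inversion cocycle -/

section Parity

variable {B W : Type*} [Group W] {M : CoxeterMatrix B} (cs : CoxeterSystem M W)

open Classical in
/-- The action of a simple reflection on `W × ZMod 2` that records the inversions. -/
noncomputable def signedConj (i : B) : Equiv.Perm (W × ZMod 2) :=
  Function.Involutive.toPerm
    (fun p => (cs.simple i * p.1 * cs.simple i, p.2 + if p.1 = cs.simple i then 1 else 0))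
    (fun p => by
      have h : cs.simple i * p.1 * cs.simple i = cs.simple i ↔ p.1 = cs.simple i := by
        rw [mul_eq_right, ← cs.inv_simple i, inv_mul_eq_one, eq_comm, cs.inv_simple]
      refine Prod.ext ?_ ?_
      · simp [← mul_assoc]
      · simp only [h, add_assoc, CharTwo.add_self_eq_zero, add_zero])

open Classical in
theorem signedConj_apply (i : B) (p : W × ZMod 2) :
    cs.signedConj i p =
      (cs.simple i * p.1 * cs.simple i, p.2 + if p.1 = cs.simple i then 1 else 0) :=
  rfl

open Classical in
theorem signedConj_mul_pow_apply (i j : B) (n : ℕ) (p : W × ZMod 2) :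
    ((cs.signedConj i * cs.signedConj j) ^ n) p =
      ((cs.simple i * cs.simple j) ^ n * p.1 * ((cs.simple i * cs.simple j) ^ n)⁻¹,
        p.2 + ∑ k ∈ Finset.range (2 * n),
          if p.1 = cs.simple j * (cs.simple i * cs.simple j) ^ k then 1 else 0) := by
  induction n with
  | zero => simp
  | succ n ih =>
    rw [pow_succ', Equiv.Perm.mul_apply, ih]
    set a := cs.simple i with ha
    set b := cs.simple j with hb
    have haa : a⁻¹ = a := cs.inv_simple i
    have hbb : b⁻¹ = b := cs.inv_simple j
    have hab : (a * b)⁻¹ = b * a := by rw [mul_inv_rev, haa, hbb]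
    have hcomm : ∀ m : ℕ, b * (a * b) ^ m = ((a * b) ^ m)⁻¹ * b := by
      intro m
      rw [← inv_pow, hab]
      induction m with
      | zero => simp
      | succ m ihm => rw [pow_succ, ← mul_assoc, ihm, pow_succ]; group
    have h1 : (a * b) ^ n * p.1 * ((a * b) ^ n)⁻¹ = b ↔ p.1 = b * (a * b) ^ (2 * n) := by
      rw [mul_inv_eq_iff_eq_mul, hcomm (2 * n), hcomm n, two_mul, pow_add, mul_inv_rev,
        mul_assoc, eq_inv_mul_iff_mul_eq, eq_inv_mul_iff_mul_eq, eq_inv_mul_iff_mul_eq]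
    have h2 : b * ((a * b) ^ n * p.1 * ((a * b) ^ n)⁻¹) * b = a ↔
        p.1 = b * (a * b) ^ (2 * n + 1) := by
      have e1 : a = b * (b * a * b) * b := by
        have : b * b = 1 := cs.simple_mul_simple_self j
        calc a = (b * b) * a * (b * b) := by simp [this]
          _ = _ := by group
      conv_lhs => rhs; rw [e1]
      rw [mul_left_inj, mul_right_inj, mul_inv_eq_iff_eq_mul, show 2 * n + 1 = (n + 1) + n by ring,
        pow_add, ← mul_assoc b, hcomm (n + 1), pow_succ', mul_inv_rev, hab]
      rw [← eq_inv_mul_iff_mul_eq]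
      have e2 : ((a * b) ^ n)⁻¹ * (b * a * b * (a * b) ^ n)
        = ((a * b) ^ n)⁻¹ * (b * a) * b * (a * b) ^ n := by group
      rw [e2]
    rw [show 2 * (n + 1) = 2 * n + 1 + 1 by ring, Finset.sum_range_succ, Finset.sum_range_succ]
    simp only [Equiv.Perm.mul_apply, signedConj_apply, ← ha, ← hb]
    refine Prod.ext ?_ ?_
    · simp only [pow_succ' (a * b) n, mul_inv_rev, haa, hbb, mul_assoc]
    · simp only [h1, h2, add_assoc]

/-- The tested elements s_j (s_i s_j)^k have period m_ij in k, so k < 2 m_ij meets each test twice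
and the signs cancel. -/
theorem isLiftable_signedConj : M.IsLiftable cs.signedConj := by
  classical
  intro i j
  ext1 p
  rw [signedConj_mul_pow_apply, cs.simple_mul_simple_pow, two_mul, Finset.sum_range_add]
  simp only [pow_add, cs.simple_mul_simple_pow, one_mul, ← two_mul]
  have h2 : (2 : ZMod 2) = 0 := rfl
  simp [h2]

/-- The homomorphism extending `signedConj`. -/
noncomputable def signedConjHom : W →* Equiv.Perm (W × ZMod 2) :=
  cs.lift ⟨cs.signedConj, cs.isLiftable_signedConj⟩

theorem signedConjHom_simple (i : B) : cs.signedConjHom (cs.simple i) = cs.signedConj i :=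
  cs.lift_apply_simple _ i

/-- The parity of the number of occurrences of `t` in the left inversion sequence of any word
for `w`. -/
noncomputable def inversionParity (w t : W) : ZMod 2 := (cs.signedConjHom w⁻¹ (t, 0)).2

theorem signedConjHom_apply (w : W) :
    ∀ p : W × ZMod 2,
      cs.signedConjHom w p = (w * p.1 * w⁻¹, p.2 + cs.inversionParity w⁻¹ p.1) := by
  induction w using cs.simple_induction_left with
  | one => intro p; simp [inversionParity]
  | mul_simple_left w i ih =>
    intro p
    have hs : ∀ q, cs.signedConjHom (cs.simple i * w) q
        = cs.signedConj i (cs.signedConjHom w q) := by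
      intro q; rw [map_mul, signedConjHom_simple]; rfl
    rw [inversionParity, inv_inv, hs, hs, ih p, ih (p.1, 0)]
    simp only [signedConj_apply, mul_inv_rev, inv_simple, mul_assoc, zero_add, add_assoc]

theorem inversionParity_mul (x y t : W) :
    cs.inversionParity (x * y) t =
      cs.inversionParity x t + cs.inversionParity y (x⁻¹ * t * x) := by
  have h : cs.signedConjHom (x * y)⁻¹ (t, 0)
      = cs.signedConjHom y⁻¹ (cs.signedConjHom x⁻¹ (t, 0)) := by
    rw [mul_inv_rev, map_mul]; rfl
  have h2 := congrArg Prod.snd h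
  simp only [signedConjHom_apply] at h2
  simpa using h2

open Classical in
theorem inversionParity_simple (i : B) (t : W) :
    cs.inversionParity (cs.simple i) t = if t = cs.simple i then 1 else 0 := by
  simp [inversionParity, signedConjHom_simple, signedConj_apply]

@[simp]
theorem inversionParity_one (t : W) : cs.inversionParity 1 t = 0 := by
  simp [inversionParity]

theorem inversionParity_simple_self (i : B) :
    cs.inversionParity (cs.simple i) (cs.simple i) = 1 := by
  simp [inversionParity_simple]

theorem mem_leftInvSeq_of_inversionParity (ω : List B) :
    ∀ t : W, cs.inversionParity (cs.wordProd ω) t ≠ 0 → t ∈ cs.leftInvSeq ω := by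
  classical
  induction ω with
  | nil => intro t ht; simp at ht
  | cons i ω ih =>
    intro t ht
    rw [wordProd_cons, inversionParity_mul, inversionParity_simple] at ht
    simp only [leftInvSeq, List.mem_cons, List.mem_map]
    by_cases h : t = cs.simple i
    · exact Or.inl h
    · right
      rw [if_neg h, zero_add] at ht
      refine ⟨_, ih _ ht, ?_⟩
      simp [MulAut.conj_apply, mul_assoc]

/-- In t = x s x⁻¹ the contributions of x and x⁻¹ cancel, as they do for x x⁻¹ = 1; only the middle
s counts. -/
theorem inversionParity_self {t : W} (ht : cs.IsReflection t) : cs.inversionParity t t = 1 := by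
  obtain ⟨x, i, rfl⟩ := ht
  have h := cs.inversionParity_mul x x⁻¹ (x * cs.simple i * x⁻¹)
  rw [mul_inv_cancel, inversionParity_one] at h
  rw [inversionParity_mul, inversionParity_mul]
  have e1 : x⁻¹ * (x * cs.simple i * x⁻¹) * x = cs.simple i := by group
  have e2 : (x * cs.simple i)⁻¹ * (x * cs.simple i * x⁻¹) * (x * cs.simple i) = cs.simple i := by
    group
  rw [e1] at h
  rw [e1, e2, inversionParity_simple_self, add_right_comm, ← h, zero_add]

theorem zmod_two_ne_zero_iff {a : ZMod 2} : a ≠ 0 ↔ a = 1 := by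
  revert a; decide

theorem mem_inversionSet_iff (w t : W) :
    t ∈ cs.inversionSet w ↔ cs.IsReflection t ∧ cs.inversionParity w t = 1 := by
  have key : ∀ w, cs.inversionParity w t ≠ 0 → cs.length (t * w) < cs.length w := by
    intro w h
    obtain ⟨ω, hω, rfl⟩ := cs.exists_isReduced w
    exact (cs.isLeftInversion_of_mem_leftInvSeq hω
      (cs.mem_leftInvSeq_of_inversionParity ω t h)).2
  refine ⟨fun ⟨ht, hl⟩ => ⟨ht, ?_⟩, fun ⟨ht, hp⟩ => ⟨ht, key w (by simp [hp])⟩⟩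
  -- If w had parity 0 at t, then tw would have parity 1, so w = t(tw) would be shorter than tw.
  by_contra hp
  have hp0 : cs.inversionParity w t = 0 := by
    by_contra h; exact hp (zmod_two_ne_zero_iff.mp h)
  have ht' : cs.IsReflection t := ht
  have h := cs.inversionParity_mul t w t
  rw [cs.inversionParity_self ht', inv_mul_cancel, one_mul, hp0, add_zero] at h
  have := key (t * w) (by simp [h])
  rw [← mul_assoc, ht'.mul_self, one_mul] at this
  omega

theorem length_lt_length_mul_iff {t : W} (ht : cs.IsReflection t) (x : W) :
    cs.length x < cs.length (x * t) ↔ cs.inversionParity x (x * t * x⁻¹) = 0 := by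
  have hr := ht.conj x
  have h := cs.mem_inversionSet_iff x (x * t * x⁻¹)
  have hne := ht.length_mul_left_ne x
  simp only [inversionSet, reflections, Set.mem_ofPred_eq, hr, true_and, inv_mul_cancel_right] at h
  rw [← not_iff_not, ← ne_eq (cs.inversionParity _ _), zmod_two_ne_zero_iff, ← h]
  omega

theorem length_lt_length_simple_mul_iff (i : B) (x : W) :
    cs.length x < cs.length (cs.simple i * x) ↔ cs.inversionParity x (cs.simple i) = 0 := by
  have hr := cs.isReflection_simple i
  have h := cs.mem_inversionSet_iff x (cs.simple i)
  have hne := hr.length_mul_right_ne x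
  simp only [inversionSet, reflections, Set.mem_ofPred_eq, hr, true_and] at h
  rw [← not_iff_not, ← ne_eq (cs.inversionParity _ _), zmod_two_ne_zero_iff, ← h]
  omega

end Parity

/-! ### Weak order as inclusion of inversion sets -/

section WeakOrder

variable {B W : Type*} [Group W] {M : CoxeterMatrix B} (cs : CoxeterSystem M W)

theorem inversionSet_subset_of_length_eq {u v : W}
    (h : cs.length v = cs.length u + cs.length (u⁻¹ * v)) :
    cs.inversionSet u ⊆ cs.inversionSet v := by
  rintro t ⟨ht, hl⟩
  refine ⟨ht, ?_⟩
  have h1 := cs.length_mul_le (t * u) (u⁻¹ * v)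
  rw [mul_assoc, mul_inv_cancel_left] at h1
  omega

theorem length_eq_of_inversionSet_subset {v : W} (n : ℕ) :
    ∀ u : W, cs.length u = n → cs.inversionSet u ⊆ cs.inversionSet v →
      cs.length v = cs.length u + cs.length (u⁻¹ * v) := by
  induction n with
  | zero =>
    intro u hu _
    rw [length_eq_zero_iff] at hu
    simp [hu]
  | succ n ih =>
    intro u hu huv
    have hu1 : u ≠ 1 := by rintro rfl; simp at hu
    obtain ⟨i, hi⟩ := cs.exists_rightDescent_of_ne_one hu1
    obtain ⟨x, rfl⟩ : ∃ x, u = x * cs.simple i := ⟨u * cs.simple i, by simp⟩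
    rw [isRightDescent_iff] at hi
    simp only [simple_mul_simple_cancel_right] at hi
    have hsi := cs.isReflection_simple i
    have hx := (cs.length_lt_length_mul_iff hsi x).mp (by omega)
    have hxu : cs.inversionSet x ⊆ cs.inversionSet (x * cs.simple i) := by
      apply cs.inversionSet_subset_of_length_eq
      simp; omega
    have hxv := ih x (by omega) (hxu.trans huv)
    have hmem : x * cs.simple i * x⁻¹ ∈ cs.inversionSet v := by
      apply huv
      rw [mem_inversionSet_iff, inversionParity_mul, hx]
      refine ⟨hsi.conj x, ?_⟩
      simp [mul_assoc, inversionParity_simple_self]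
    rw [mem_inversionSet_iff] at hmem
    have h2 := hmem.2
    have e : v = x * (x⁻¹ * v) := by group
    rw [e, inversionParity_mul, hx, zero_add] at h2
    have h3 : ¬ cs.length (x⁻¹ * v) < cs.length (cs.simple i * (x⁻¹ * v)) := by
      rw [length_lt_length_simple_mul_iff]
      have : x⁻¹ * (x * cs.simple i * x⁻¹) * x = cs.simple i := by group
      rw [this] at h2
      simp [h2]
    have h4 := cs.length_simple_mul (x⁻¹ * v) i
    have e2 : (x * cs.simple i)⁻¹ * v = cs.simple i * (x⁻¹ * v) := by
      rw [mul_inv_rev, inv_simple, mul_assoc]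
    rw [e2]
    omega

theorem rightWeakOrder_le_iff (u v : W) :
    cs.rightWeakOrder.le u v ↔ cs.inversionSet u ⊆ cs.inversionSet v :=
  ⟨cs.inversionSet_subset_of_length_eq, cs.length_eq_of_inversionSet_subset _ u rfl⟩

/-- A proper inclusion of inversion sets is refined by a cover of the smaller element. -/
theorem exists_simple_of_inversionSet_subset {x u : W}
    (h : cs.inversionSet x ⊆ cs.inversionSet u) (hne : x ≠ u) :
    ∃ i : B, cs.length (x * cs.simple i) = cs.length x + 1 ∧
      cs.inversionSet (x * cs.simple i) ⊆ cs.inversionSet u := by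
  have hl := cs.length_eq_of_inversionSet_subset _ x rfl h
  obtain ⟨i, hi⟩ := cs.exists_leftDescent_of_ne_one (w := x⁻¹ * u)
    (fun h1 => hne (inv_mul_eq_one.mp h1))
  rw [isLeftDescent_iff] at hi
  have e : (x * cs.simple i)⁻¹ * u = cs.simple i * (x⁻¹ * u) := by
    rw [mul_inv_rev, inv_simple, mul_assoc]
  have h1 := cs.length_mul_le (x * cs.simple i) ((x * cs.simple i)⁻¹ * u)
  rw [mul_inv_cancel_left, e] at h1
  have h2 := cs.length_mul_simple x i
  refine ⟨i, by omega, cs.inversionSet_subset_of_length_eq ?_⟩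
  rw [e]
  omega

end WeakOrder

/-! ### Inversion sets are closed -/

section Preclosure

variable {B W : Type*} [Group W] {M : CoxeterMatrix B} (cs : CoxeterSystem M W)

theorem bruhatPreclosure_subset_reflections (A : Set W) :
    cs.bruhatPreclosure A ⊆ cs.reflections :=
  fun _ h => h.1

theorem bruhatPreclosure_mono : Monotone cs.bruhatPreclosure := by
  rintro A A' h t ⟨ht, hp⟩
  exact ⟨ht, Relation.ReflTransGen.mono (fun _ _ ⟨t, htA, he⟩ => ⟨t, h htA, he⟩) _ _ hp⟩

theorem subset_bruhatPreclosure {A : Set W} (hA : A ⊆ cs.reflections) :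
    A ⊆ cs.bruhatPreclosure A := by
  intro t ht
  refine ⟨hA ht, Relation.ReflTransGen.single ⟨t, ht, hA ht, by simp, ?_⟩⟩
  have hr : cs.IsReflection t := hA ht
  have := hr.odd_length.pos
  simpa using this

/-- For an edge y → yt with t in N(w), the reflection y t y⁻¹ inverts yw, so the length of yw drops
along the path. -/
theorem length_mul_le_of_existsBruhatPath {w x : W}
    (h : cs.ExistsBruhatPath (cs.inversionSet w) 1 x) : cs.length (x * w) ≤ cs.length w := by
  induction h with
  | refl => simp
  | @tail y z _ hyz ih =>
    obtain ⟨t, htw, ht, rfl, hl⟩ := hyz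
    have ht' : cs.IsReflection t := ht
    refine le_trans (le_of_lt ?_) ih
    have hy := (cs.length_lt_length_mul_iff ht' y).mp hl
    have hm : y * t * y⁻¹ ∈ cs.inversionSet (y * w) := by
      rw [mem_inversionSet_iff] at htw ⊢
      refine ⟨ht'.conj y, ?_⟩
      rw [inversionParity_mul, hy, zero_add]
      simpa [mul_assoc] using htw.2
    have := hm.2
    simpa [mul_assoc] using this

theorem bruhatPreclosure_inversionSet_subset (w : W) :
    cs.bruhatPreclosure (cs.inversionSet w) ⊆ cs.inversionSet w := by
  rintro t ⟨ht, hp⟩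
  have ht' : cs.IsReflection t := ht
  exact ⟨ht, lt_of_le_of_ne (cs.length_mul_le_of_existsBruhatPath hp) (ht'.length_mul_right_ne w)⟩

end Preclosure

/-! ### Parabolic subgroups and local upper bounds -/

section Parabolic

variable {B W : Type*} [Group W] {M : CoxeterMatrix B} (cs : CoxeterSystem M W)

/-- The standard parabolic subgroup generated by the simple reflections in `J`. -/
def parabolic (J : Set B) : Subgroup W := Subgroup.closure (cs.simple '' J)

variable {cs} in
theorem simple_mem_parabolic {J : Set B} {i : B} (hi : i ∈ J) : cs.simple i ∈ cs.parabolic J :=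
  Subgroup.subset_closure ⟨i, hi, rfl⟩

theorem exists_isReduced_sublist (ω : List B) :
    ∃ ω' : List B, ω'.Sublist ω ∧ cs.IsReduced ω' ∧ cs.wordProd ω' = cs.wordProd ω := by
  classical
  induction ω with
  | nil => exact ⟨[], List.Sublist.refl _, by simp [IsReduced], rfl⟩
  | cons i ω ih =>
    obtain ⟨ω', hs, hr, hp⟩ := ih
    by_cases hlt : cs.length (cs.wordProd ω') < cs.length (cs.simple i * cs.wordProd ω')
    · refine ⟨i :: ω', hs.cons_cons i, ?_, by rw [wordProd_cons, wordProd_cons, hp]⟩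
      have h1 := cs.length_simple_mul (cs.wordProd ω') i
      have h2 := hr.eq
      unfold IsReduced
      rw [wordProd_cons, List.length_cons]
      omega
    -- Deletion: s_i lies in the inversion sequence of the reduced word, so multiplying by it erases
    -- a letter.
    · have hpar := (cs.length_lt_length_simple_mul_iff i (cs.wordProd ω')).not.mp hlt
      have hmem := cs.mem_leftInvSeq_of_inversionParity ω' _ hpar
      obtain ⟨j, hj, hji⟩ := List.getElem_of_mem hmem
      have hd := cs.getD_leftInvSeq_mul_wordProd ω' j
      rw [List.getD_eq_getElem _ _ hj, hji] at hd
      refine ⟨ω'.eraseIdx j, ((List.eraseIdx_sublist ω' j).trans hs).cons i, ?_, ?_⟩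
      · have h1 := cs.length_simple_mul (cs.wordProd ω') i
        have h2 := hr.eq
        rw [length_leftInvSeq] at hj
        have h3 := List.length_eraseIdx_add_one hj
        unfold IsReduced
        rw [← hd]
        omega
      · rw [← hd, wordProd_cons, hp]

theorem exists_isReduced_of_mem_parabolic {J : Set B} {g : W} (hg : g ∈ cs.parabolic J) :
    ∃ ω : List B, cs.IsReduced ω ∧ (∀ k ∈ ω, k ∈ J) ∧ g = cs.wordProd ω := by
  suffices h : ∃ ω : List B, (∀ k ∈ ω, k ∈ J) ∧ g = cs.wordProd ω by
    obtain ⟨ω, hJ, rfl⟩ := h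
    obtain ⟨ω', hs, hr, hp⟩ := cs.exists_isReduced_sublist ω
    exact ⟨ω', hr, fun k hk => hJ k (hs.subset hk), hp.symm⟩
  induction hg using Subgroup.closure_induction with
  | mem x hx =>
    obtain ⟨i, hi, rfl⟩ := hx
    exact ⟨[i], by simpa using hi, by simp⟩
  | one => exact ⟨[], by simp, by simp⟩
  | mul x y _ _ hx hy =>
    obtain ⟨ω₁, h₁, rfl⟩ := hx
    obtain ⟨ω₂, h₂, rfl⟩ := hy
    refine ⟨ω₁ ++ ω₂, fun k hk => ?_, by rw [wordProd_append]⟩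
    rcases List.mem_append.mp hk with hk | hk
    · exact h₁ k hk
    · exact h₂ k hk
  | inv x _ hx =>
    obtain ⟨ω, h, rfl⟩ := hx
    exact ⟨ω.reverse, fun k hk => h k (List.mem_reverse.mp hk), by simp⟩

theorem wordProd_mem_parabolic {J : Set B} {ω : List B} (h : ∀ k ∈ ω, k ∈ J) :
    cs.wordProd ω ∈ cs.parabolic J := by
  induction ω with
  | nil => simp
  | cons i ω ih =>
    rw [wordProd_cons]
    exact mul_mem (simple_mem_parabolic (h i (by simp))) (ih fun k hk => h k (by simp [hk]))

theorem mem_parabolic_of_inversionParity {J : Set B} {ω : List B} (h : ∀ k ∈ ω, k ∈ J) :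
    ∀ t : W, cs.inversionParity (cs.wordProd ω) t ≠ 0 → t ∈ cs.parabolic J := by
  classical
  induction ω with
  | nil => intro t ht; simp at ht
  | cons i ω ih =>
    intro t ht
    have hi : cs.simple i ∈ cs.parabolic J := simple_mem_parabolic (h i (by simp))
    rw [wordProd_cons, inversionParity_mul, inversionParity_simple] at ht
    by_cases hti : t = cs.simple i
    · rwa [hti]
    · rw [if_neg hti, zero_add] at ht
      have := ih (fun k hk => h k (by simp [hk])) _ ht
      rwa [Subgroup.mul_mem_cancel_right _ hi, Subgroup.mul_mem_cancel_left _ (inv_mem hi)] at this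

/-- An element without right descents in `J` has no right inversions in the parabolic subgroup. -/
theorem inversionParity_conj_eq_zero {J : Set B} {x : W}
    (hx : ∀ i ∈ J, cs.length x < cs.length (x * cs.simple i)) {t : W} (ht : cs.IsReflection t)
    (htJ : t ∈ cs.parabolic J) : cs.inversionParity x (x * t * x⁻¹) = 0 := by
  rw [← cs.length_lt_length_mul_iff ht]
  -- The claim holds at a shortest element xg of the coset. If g ≠ 1 starts with s, the cocycle on x
  -- = (xg)g⁻¹ would make g⁻¹s longer than g⁻¹, which is false.
  obtain ⟨g, hgJ, hmin⟩ : ∃ g ∈ cs.parabolic J, ∀ h ∈ cs.parabolic J,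
      cs.length (x * g) ≤ cs.length (x * h) := by
    have hne : {n | ∃ g ∈ cs.parabolic J, cs.length (x * g) = n}.Nonempty :=
      ⟨_, 1, one_mem _, rfl⟩
    obtain ⟨g, hg, hn⟩ := Nat.sInf_mem hne
    exact ⟨g, hg, fun h hh => hn ▸ Nat.sInf_le ⟨h, hh, rfl⟩⟩
  have hz : ∀ r, cs.IsReflection r → r ∈ cs.parabolic J →
      cs.inversionParity (x * g) (x * g * r * (x * g)⁻¹) = 0 := by
    intro r hr hrJ
    rw [← cs.length_lt_length_mul_iff hr]
    refine lt_of_le_of_ne ?_ (hr.length_mul_left_ne _).symm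
    rw [mul_assoc x g r]
    exact hmin _ (mul_mem hgJ hrJ)
  suffices hg1 : g = 1 by
    subst hg1
    rw [cs.length_lt_length_mul_iff ht]
    simpa using hz t ht htJ
  obtain ⟨ω, hr, hω, he⟩ := cs.exists_isReduced_of_mem_parabolic hgJ
  cases ω with
  | nil => simpa using he
  | cons i ω =>
    exfalso
    have hi : i ∈ J := hω i (by simp)
    have hsi := cs.isReflection_simple i
    have hxi := (cs.length_lt_length_mul_iff hsi x).mp (hx i hi)
    have e : x = (x * g) * g⁻¹ := by group
    rw [e, inversionParity_mul, ← e] at hxi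
    have e1 : x * cs.simple i * x⁻¹ = (x * g) * (g⁻¹ * cs.simple i * g⁻¹⁻¹) * (x * g)⁻¹ := by group
    have hz1 := hz _ (hsi.conj g⁻¹)
      (mul_mem (mul_mem (inv_mem hgJ) (simple_mem_parabolic hi)) (inv_mem (inv_mem hgJ)))
    have e2 : (x * g)⁻¹ * (x * cs.simple i * x⁻¹) * (x * g) = g⁻¹ * cs.simple i * g⁻¹⁻¹ := by group
    rw [e2] at hxi
    rw [e1, hz1, zero_add, ← cs.length_lt_length_mul_iff hsi] at hxi
    have h1 := cs.length_inv (g⁻¹ * cs.simple i)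
    rw [mul_inv_rev, inv_inv, inv_simple, he, wordProd_cons, simple_mul_simple_cancel_left] at h1
    rw [he, wordProd_cons, ← h1, length_inv, ← wordProd_cons, hr.eq, List.length_cons] at hxi
    have := cs.length_wordProd_le ω
    omega

/-- The path runs through the prefixes of ω conjugated by x. Each step ascends because the cocycle
contributions of x, g and x⁻¹ all vanish. -/
theorem existsBruhatPath_conj {J : Set B} {x : W} {C : Set W}
    (hx : ∀ i ∈ J, cs.length x < cs.length (x * cs.simple i))
    (hC : ∀ i ∈ J, x * cs.simple i * x⁻¹ ∈ C) (ω : List B) (hr : cs.IsReduced ω)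
    (hω : ∀ k ∈ ω, k ∈ J) : cs.ExistsBruhatPath C 1 (x * cs.wordProd ω * x⁻¹) := by
  induction ω using List.reverseRecOn with
  | nil =>
    simp only [wordProd_nil, mul_one, mul_inv_cancel]
    exact Relation.ReflTransGen.refl
  | append_singleton ω i ih =>
    have hi : i ∈ J := hω i (by simp)
    have hωJ : ∀ k ∈ ω, k ∈ J := fun k hk => hω k (by simp [hk])
    have hr' : cs.IsReduced ω := by
      have := hr.take ω.length
      rwa [List.take_left] at this
    refine Relation.ReflTransGen.tail (ih hr' hωJ)
      ⟨x * cs.simple i * x⁻¹, hC i hi, (cs.isReflection_simple i).conj x, ?_, ?_⟩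
    · simp [wordProd_append, mul_assoc]
    · set g := cs.wordProd ω with hg
      have hgJ : g ∈ cs.parabolic J := cs.wordProd_mem_parabolic hωJ
      have hsi := cs.isReflection_simple i
      have e : x * cs.wordProd (ω ++ [i]) * x⁻¹ = x * g * x⁻¹ * (x * cs.simple i * x⁻¹) := by
        simp [wordProd_append, mul_assoc, hg]
      have hgi : cs.inversionParity g (g * cs.simple i * g⁻¹) = 0 := by
        rw [← cs.length_lt_length_mul_iff hsi]
        have h1 := hr.eq
        rw [wordProd_append, wordProd_singleton, List.length_append, ← hr'.eq] at h1
        simp only [List.length_singleton, ← hg] at h1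
        omega
      have hxi : cs.inversionParity x⁻¹ (cs.simple i) = 0 := by
        rw [← length_lt_length_simple_mul_iff]
        have h1 := cs.length_inv (cs.simple i * x⁻¹)
        rw [mul_inv_rev, inv_inv, inv_simple] at h1
        have := hx i hi
        rw [length_inv]
        omega
      have hxg := cs.inversionParity_conj_eq_zero hx (hsi.conj g)
        (mul_mem (mul_mem hgJ (simple_mem_parabolic hi)) (inv_mem hgJ))
      rw [e, cs.length_lt_length_mul_iff (hsi.conj x), inversionParity_mul, inversionParity_mul]
      have e1 : x * g * x⁻¹ * (x * cs.simple i * x⁻¹) * (x * g * x⁻¹)⁻¹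
          = x * (g * cs.simple i * g⁻¹) * x⁻¹ := by group
      have e2 : x⁻¹ * (x * (g * cs.simple i * g⁻¹) * x⁻¹) * x = g * cs.simple i * g⁻¹ := by group
      have e3 : (x * g)⁻¹ * (x * (g * cs.simple i * g⁻¹) * x⁻¹) * (x * g) = cs.simple i := by group
      rw [e1, e2, e3, hxg, hgi, hxi]
      simp

/-- Upper covers of `x` have an upper bound whose inversions lie in every closed set containing
the inversions of the covers. -/
theorem exists_local_upperBound [Finite W] {J : Set B} (hJ : J.Nonempty) {x : W}
    (hx : ∀ i ∈ J, cs.length x < cs.length (x * cs.simple i)) :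
    ∃ z : W, (∀ i ∈ J, cs.inversionSet (x * cs.simple i) ⊆ cs.inversionSet z) ∧
      ∀ C : Set W, cs.bruhatPreclosure C ⊆ C →
        (∀ i ∈ J, cs.inversionSet (x * cs.simple i) ⊆ C) → cs.inversionSet z ⊆ C := by
  classical
  obtain ⟨y, hyJ, hmax⟩ := Set.exists_max_image (cs.parabolic J : Set W) cs.length
    (Set.toFinite _) ⟨1, one_mem _⟩
  obtain ⟨ω, -, hω, hyω⟩ := cs.exists_isReduced_of_mem_parabolic hyJ
  have hpar : ∀ t, cs.inversionParity y t ≠ 0 → t ∈ cs.parabolic J := by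
    rw [hyω]; exact cs.mem_parabolic_of_inversionParity hω
  have hconj : ∀ t : W, t = x * (x⁻¹ * t * x) * x⁻¹ := fun t => by group
  have hrefl : ∀ t : W, cs.IsReflection t → cs.IsReflection (x⁻¹ * t * x) := fun t ht => by
    simpa using ht.conj x⁻¹
  refine ⟨x * y, fun i hi t ht => ?_, fun C hC hxC t ht => ?_⟩
  · rw [mem_inversionSet_iff, inversionParity_mul] at ht ⊢
    refine ⟨ht.1, ?_⟩
    have hyi : cs.inversionParity y (cs.simple i) ≠ 0 := by
      rw [ne_eq, ← length_lt_length_simple_mul_iff, not_lt]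
      exact hmax _ (mul_mem (simple_mem_parabolic hi) hyJ)
    by_cases hti : x⁻¹ * t * x = cs.simple i
    · rw [hti] at ht ⊢
      rw [zmod_two_ne_zero_iff.mp hyi]
      rw [inversionParity_simple_self] at ht
      exact ht.2
    · have h2 := ht.2
      rw [inversionParity_simple, if_neg hti, add_zero] at h2
      rw [h2]
      -- Here t inverts x; were y to contribute too, x⁻¹ t x would be a reflection in the parabolic
      -- subgroup, which `inversionParity_conj_eq_zero` forbids.
      by_cases h0 : cs.inversionParity y (x⁻¹ * t * x) = 0
      · rw [h0, add_zero]
      · have h3 := cs.inversionParity_conj_eq_zero hx (hrefl t ht.1) (hpar _ h0)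
        rw [← hconj, h2] at h3
        exact absurd h3 one_ne_zero
  · rw [mem_inversionSet_iff, inversionParity_mul] at ht
    by_cases h0 : cs.inversionParity y (x⁻¹ * t * x) = 0
    · obtain ⟨i, hi⟩ := hJ
      apply hxC i hi
      rw [h0, add_zero] at ht
      have hxi : cs.inversionSet x ⊆ cs.inversionSet (x * cs.simple i) := by
        apply cs.inversionSet_subset_of_length_eq
        have h1 := cs.length_mul_simple x i
        have h2 := hx i hi
        rw [inv_mul_cancel_left, length_simple]
        omega
      exact hxi ((cs.mem_inversionSet_iff x t).mpr ht)
    · obtain ⟨ω', hr', hω', ht'⟩ := cs.exists_isReduced_of_mem_parabolic (hpar _ h0)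
      apply hC
      refine ⟨ht.1, ?_⟩
      rw [hconj t, ht']
      refine cs.existsBruhatPath_conj hx (fun i hi => hxC i hi ?_) ω' hr' hω'
      have hsi := cs.isReflection_simple i
      rw [mem_inversionSet_iff, inversionParity_mul,
        (cs.length_lt_length_mul_iff hsi x).mp (hx i hi)]
      refine ⟨hsi.conj x, ?_⟩
      simp [mul_assoc, inversionParity_simple_self]

end Parabolic

/-! ### Global upper bound and stabilization -/

section Join

variable {B W : Type*} [Group W] {M : CoxeterMatrix B} (cs : CoxeterSystem M W)

theorem exists_upperBound_of_lowerBound [Finite W] {L : ℕ} (hL : ∀ w, cs.length w ≤ L) (n : ℕ) :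
    ∀ x u v : W, L - cs.length x ≤ n → cs.inversionSet x ⊆ cs.inversionSet u →
      cs.inversionSet x ⊆ cs.inversionSet v →
      ∃ w : W, cs.inversionSet u ⊆ cs.inversionSet w ∧ cs.inversionSet v ⊆ cs.inversionSet w ∧
        ∀ C : Set W, cs.bruhatPreclosure C ⊆ C → cs.inversionSet u ⊆ C → cs.inversionSet v ⊆ C →
          cs.inversionSet w ⊆ C := by
  induction n with
  | zero =>
    intro x u v hn hu hv
    refine ⟨v, ?_, subset_rfl, fun C _ _ h => h⟩
    by_cases hxu : x = u
    · exact hxu ▸ hv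
    -- At maximal length x has no proper upper cover.
    · obtain ⟨i, hi, -⟩ := cs.exists_simple_of_inversionSet_subset hu hxu
      have := hL (x * cs.simple i)
      omega
  | succ n ih =>
    intro x u v hn hu hv
    by_cases hxu : x = u
    · exact ⟨v, hxu ▸ hv, subset_rfl, fun C _ _ h => h⟩
    by_cases hxv : x = v
    · exact ⟨u, subset_rfl, hxv ▸ hu, fun C _ h _ => h⟩
    obtain ⟨i, hi, hiu⟩ := cs.exists_simple_of_inversionSet_subset hu hxu
    obtain ⟨j, hj, hjv⟩ := cs.exists_simple_of_inversionSet_subset hv hxv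
    obtain ⟨z, hz, hzC⟩ := cs.exists_local_upperBound (J := {i, j}) (x := x) ⟨i, by simp⟩ (by
      rintro k (rfl | rfl) <;> omega)
    obtain ⟨w₁, hu₁, hz₁, hC₁⟩ := ih (x * cs.simple i) u z (by omega) hiu (hz i (by simp))
    obtain ⟨w, h₁, hvw, hC⟩ := ih (x * cs.simple j) w₁ v (by omega)
      ((hz j (by simp)).trans hz₁) hjv
    refine ⟨w, hu₁.trans h₁, hvw, fun C hCC huC hvC => hC C hCC (hC₁ C hCC huC ?_) hvC⟩
    apply hzC C hCC
    rintro k (rfl | rfl)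
    · exact hiu.trans huC
    · exact hjv.trans hvC

theorem exists_upperBound_subset_closed [Finite W] (u v : W) :
    ∃ w : W, cs.inversionSet u ⊆ cs.inversionSet w ∧ cs.inversionSet v ⊆ cs.inversionSet w ∧
      ∀ C : Set W, cs.bruhatPreclosure C ⊆ C → cs.inversionSet u ⊆ C → cs.inversionSet v ⊆ C →
        cs.inversionSet w ⊆ C := by
  obtain ⟨L, hL⟩ := (Set.finite_range cs.length).bddAbove
  have h1 : cs.inversionSet (1 : W) = ∅ := by
    ext t
    simp [mem_inversionSet_iff]
  exact cs.exists_upperBound_of_lowerBound (fun w => hL ⟨w, rfl⟩) L 1 u v (by simp)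
    (by simp [h1]) (by simp [h1])

theorem iterate_bruhatPreclosure_subset_reflections {A : Set W} (hA : A ⊆ cs.reflections) (k : ℕ) :
    cs.bruhatPreclosure^[k] A ⊆ cs.reflections := by
  cases k with
  | zero => exact hA
  | succ k =>
    rw [Function.iterate_succ_apply']
    exact cs.bruhatPreclosure_subset_reflections _

theorem subset_iterate_bruhatPreclosure {A : Set W} (hA : A ⊆ cs.reflections) (k : ℕ) :
    A ⊆ cs.bruhatPreclosure^[k] A := by
  induction k with
  | zero => exact subset_rfl
  | succ k ih =>
    rw [Function.iterate_succ_apply']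
    exact ih.trans
      (cs.subset_bruhatPreclosure (cs.iterate_bruhatPreclosure_subset_reflections hA k))

theorem iterate_bruhatPreclosure_subset {A C : Set W} (hC : cs.bruhatPreclosure C ⊆ C)
    (hAC : A ⊆ C) (k : ℕ) : cs.bruhatPreclosure^[k] A ⊆ C := by
  induction k with
  | zero => exact hAC
  | succ k ih =>
    rw [Function.iterate_succ_apply']
    exact (cs.bruhatPreclosure_mono ih).trans hC

theorem exists_iterate_bruhatPreclosure_closed [Finite W] {A : Set W} (hA : A ⊆ cs.reflections) :
    ∃ i ≤ cs.reflections.ncard - A.ncard,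
      cs.bruhatPreclosure (cs.bruhatPreclosure^[i] A) ⊆ cs.bruhatPreclosure^[i] A := by
  by_contra! hcon
  -- Each unstable iterate gains a reflection, so one step past the bound would exceed |T|.
  have hgrow : ∀ k ≤ cs.reflections.ncard - A.ncard + 1,
      A.ncard + k ≤ (cs.bruhatPreclosure^[k] A).ncard := by
    intro k
    induction k with
    | zero => simp
    | succ k ih =>
      intro hk
      rw [Function.iterate_succ_apply']
      have hlt := Set.ncard_lt_ncard ⟨cs.subset_bruhatPreclosure
        (cs.iterate_bruhatPreclosure_subset_reflections hA k), hcon k (by omega)⟩ (Set.toFinite _)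
      have := ih (by omega)
      omega
  have h1 := hgrow _ le_rfl
  have h2 := Set.ncard_le_ncard
    (cs.iterate_bruhatPreclosure_subset_reflections hA (cs.reflections.ncard - A.ncard + 1))
    (Set.toFinite _)
  omega

end Join

end CoxeterSystem

theorem mainTheorem6 {B W : Type*} [Group W] [Finite W] {M : CoxeterMatrix B}
    (cs : CoxeterSystem M W) (u v : W) :
    ∃ w : W, cs.IsRightWeakJoin u v w ∧
      ∃ i : ℕ, i ≤ cs.reflections.ncard - (cs.inversionSet u ∪ cs.inversionSet v).ncard ∧
        cs.inversionSet w =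
          cs.bruhatPreclosure^[i] (cs.inversionSet u ∪ cs.inversionSet v) := by
  obtain ⟨w, huw, hvw, hw⟩ := cs.exists_upperBound_subset_closed u v
  have hA : cs.inversionSet u ∪ cs.inversionSet v ⊆ cs.reflections :=
    Set.union_subset (fun _ h => h.1) (fun _ h => h.1)
  refine ⟨w, ⟨?_, fun x hx => ?_⟩, ?_⟩
  · rintro x (rfl | rfl)
    · exact (cs.rightWeakOrder_le_iff _ _).mpr huw
    · exact (cs.rightWeakOrder_le_iff _ _).mpr hvw
  · refine (cs.rightWeakOrder_le_iff _ _).mpr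
      (hw _ (cs.bruhatPreclosure_inversionSet_subset x) ?_ ?_)
    · exact (cs.rightWeakOrder_le_iff _ _).mp (hx (by simp))
    · exact (cs.rightWeakOrder_le_iff _ _).mp (hx (by simp))
  · obtain ⟨i, hi, hcl⟩ := cs.exists_iterate_bruhatPreclosure_closed hA
    have hsub := cs.subset_iterate_bruhatPreclosure hA i
    exact ⟨i, hi, (hw _ hcl (Set.subset_union_left.trans hsub)
      (Set.subset_union_right.trans hsub)).antisymm
      (cs.iterate_bruhatPreclosure_subset (cs.bruhatPreclosure_inversionSet_subset w)
        (Set.union_subset huw hvw) i)⟩
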